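/- Let $G$ be a finite connected planar embedded graph (loops and parallel edges allowed) with dual $G^*$, and fix an infinite face of $G^*$. Let the edges of $G^*$ have weights in $[0,\infty]$ such that any two vertices of $G^*$ are joined by a walk of finite weight. Let $X$ be a set of vertices of $G$, the terminals; each vertex of $G$ is a face of $G^*$, so the terminals are faces of $G^*$. A simple cycle of $G^*$ encloses a face if it separates that face from the infinite face; it is terminal-separating if it encloses at least one terminal and at least one terminal is not enclosed by it. The length of a cycle is the sum of its edge weights. For a simple cycle $S^*$, the graph $int(S^*)$ (respectively $ext(S^*)$) consists of the edges of $G^*$ that are incident to a face enclosed by $S^*$ (respectively, to a face not enclosed by $S^*$); a cycle crosses $S^*$ if it is contained neither in $int(S^*)$ nor in $ext(S^*)$. Let $T^*$ be a shortest-path tree of $G^*$ (a spanning tree) rooted at a vertex $r$ that is incident to a terminal face $v^*_t$. Let $e$ be an edge of $G^*$ not in $T^*$, and let $P^*_a$, $P^*_b$ be the paths of $T^*$ from the lowest common ancestor of the two endpoints of $e$ to these two endpoints, so that $S^* = P^*_a\, e\, P^*_b$ is the fundamental cycle of $e$ with respect to $T^*$. Let $v^*_e$ be a face of $G^*$ incident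 to $e$. Let $C^*$ be any terminal-separating simple cycle of $G^*$ such that (i) $C^*$ encloses both $v^*_e$ and $v^*$ for some face $v^*$ that is not enclosed by $S^*$ and is incident to the parentmost edge of $P^*_b$ (the edge of $P^*_b$ closest to $r$ in $T^*$; here $P^*_b$ has at least one edge), or (ii) $C^*$ encloses both $v^*_t$ and $v^*_e$. Then there is a terminal-separating simple cycle of $G^*$ that does not cross $S^*$ and whose length is at most the length of $C^*$. -/

import Mathlib

open scoped ENNReal

/-- A finite graph (loops and parallel edges allowed) embedded in an oriented closed surface, given
combinatorially. `D` is the set of darts, `rev` sends a dart to the oppositely directed dart of the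
same edge, `vnext d` is the next dart in clockwise order among the darts with the same tail as `d`,
and `fnext d` is the dart that follows `d` when one walks along the boundary of the face to the
left of `d`. Vertices, edges and faces are the orbits of `vnext`, `rev` and `fnext`. -/
structure RotationSystem (D : Type*) where
  rev : Equiv.Perm D
  vnext : Equiv.Perm D
  fnext : Equiv.Perm D
  rev_rev : ∀ d, rev (rev d) = d
  rev_ne : ∀ d, rev d ≠ d
  fnext_eq : ∀ d, fnext d = vnext (rev d)

namespace RotationSystem

variable {D : Type*} (H : RotationSystem D)

/-- Vertices: orbits of `vnext`. -/
def Vertex : Type _ := Quotient (Equiv.Perm.SameCycle.setoid H.vnext)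

/-- Undirected edges: orbits `{d, rev d}` of `rev`. -/
def Edge : Type _ := Quotient (Equiv.Perm.SameCycle.setoid H.rev)

/-- Faces: orbits of `fnext`. -/
def Face : Type _ := Quotient (Equiv.Perm.SameCycle.setoid H.fnext)

/-- The tail of a dart. -/
def tail (d : D) : H.Vertex := Quotient.mk (Equiv.Perm.SameCycle.setoid H.vnext) d

/-- The head of a dart. -/
def head (d : D) : H.Vertex := H.tail (H.rev d)

/-- The undirected edge underlying a dart. -/
def edge (d : D) : H.Edge := Quotient.mk (Equiv.Perm.SameCycle.setoid H.rev) d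

/-- The face to the left of a dart; the face to its right is `face (rev d)`. -/
def face (d : D) : H.Face := Quotient.mk (Equiv.Perm.SameCycle.setoid H.fnext) d

/-- `p` is the list of darts of a walk from `u` to `v`. -/
def IsWalk : H.Vertex → List D → H.Vertex → Prop
  | u, [], v => u = v
  | u, d :: p, v => H.tail d = u ∧ IsWalk (H.head d) p v

/-- A connected plane graph (an embedding in the sphere): the graph is connected and
Euler's formula `|V| - |E| + |F| = 2` holds. -/
structure IsPlane : Prop where
  connected : ∀ u v : H.Vertex, ∃ p : List D, H.IsWalk u p v
  euler : Nat.card H.Vertex + Nat.card H.Face = Nat.card H.Edge + 2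

/-- The dual embedded graph. It has the same darts and the same edges; its vertices are the faces
of `H`, its faces are the vertices of `H`, and the dual of a dart `d` points from the face to the
left of `d` to the face to the right of `d`. -/
def dual : RotationSystem D where
  rev := H.rev
  vnext := H.fnext
  fnext := H.vnext
  rev_rev := H.rev_rev
  rev_ne := H.rev_ne
  fnext_eq := fun d => by rw [H.fnext_eq, H.rev_rev]

/-- A walk that visits no vertex twice. -/
def IsPath (u : H.Vertex) (p : List D) (v : H.Vertex) : Prop :=
  H.IsWalk u p v ∧ (u :: p.map H.head).Nodup

/-- A simple cycle, as the cyclic list of its darts in one of the two directions: a nonempty closed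
walk that repeats no vertex and no edge (a loop and a pair of parallel edges are simple cycles). -/
def IsCycle (c : List D) : Prop :=
  c ≠ [] ∧ (∃ u, H.IsWalk u c u) ∧ (c.map H.tail).Nodup ∧ (c.map H.edge).Nodup

/-- The walk `p` traversed backwards. -/
def revWalk (p : List D) : List D := (p.map H.rev).reverse

/-- The length of a list of darts with respect to the edge weights `w`. -/
noncomputable def length (w : H.Edge → ℝ≥0∞) (p : List D) : ℝ≥0∞ :=
  (p.map fun d => w (H.edge d)).sum

/-- All edges of `p` belong to `T`. -/
def EdgesIn (T : Set H.Edge) (p : List D) : Prop := ∀ d ∈ p, H.edge d ∈ T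

/-- `T` is the edge set of a spanning tree: it connects all vertices and contains no cycle. -/
def IsSpanningTree (T : Set H.Edge) : Prop :=
  (∀ u v, ∃ p, H.IsWalk u p v ∧ H.EdgesIn T p) ∧ ∀ c, H.IsCycle c → ¬ H.EdgesIn T c

/-- `T` is a shortest-path tree rooted at `r`: a spanning tree whose path from `r` to any vertex
is a shortest walk between the two. -/
def IsShortestPathTree (w : H.Edge → ℝ≥0∞) (r : H.Vertex) (T : Set H.Edge) : Prop :=
  H.IsSpanningTree T ∧
    ∀ v p q, H.IsPath r p v → H.EdgesIn T p → H.IsWalk r q v → H.length w p ≤ H.length w q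

/-- The cycle that runs along `Pa`, then through the edge of the dart `d`, and back along `Pb`. -/
def sepCycle (Pa : List D) (d : D) (Pb : List D) : List D := Pa ++ d :: H.revWalk Pb

/-- In the tree `T` with root `r`, the walks `Pa` and `Pb` are the two tree paths, directed away
from the root, which lead from the lowest common ancestor of the ends of the non-tree dart `d` to
the tail and to the head of `d`. (`Q` is the tree path from `r` to that ancestor.) Together with
`d` they form the fundamental cycle `sepCycle Pa d Pb` of `d`. -/
def IsFundamentalCycle (T : Set H.Edge) (r : H.Vertex) (Pa : List D) (d : D) (Pb : List D) :
    Prop :=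
  H.edge d ∉ T ∧ H.IsCycle (H.sepCycle Pa d Pb) ∧
    ∃ Q : List D,
      H.IsPath r (Q ++ Pa) (H.tail d) ∧ H.EdgesIn T (Q ++ Pa) ∧
      H.IsPath r (Q ++ Pb) (H.head d) ∧ H.EdgesIn T (Q ++ Pb)

/-- The face `f` is incident to the edge of the dart `d`. -/
def FaceIncEdge (f : H.Face) (d : D) : Prop := f = H.face d ∨ f = H.face (H.rev d)

/-- The face `f` is incident to the vertex `v`. -/
def FaceIncVertex (f : H.Face) (v : H.Vertex) : Prop := ∃ d, H.tail d = v ∧ H.face d = f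

/-- The faces `f` and `g` share an edge that is not on `c`. -/
def FaceStep (c : List D) (f g : H.Face) : Prop :=
  ∃ d, H.edge d ∉ c.map H.edge ∧ H.face d = f ∧ H.face (H.rev d) = g

/-- With `o` as the infinite face, the cycle `c` encloses the face `f`: one cannot get from `f` to
`o` through the faces without crossing `c`. -/
def Encloses (o : H.Face) (c : List D) (f : H.Face) : Prop :=
  ¬ Relation.ReflTransGen (H.FaceStep c) f o

/-- The cycle `c` has a terminal inside and a terminal outside. -/
def TerminalSeparating (o : H.Face) (X : Set H.Face) (c : List D) : Prop :=
  (∃ x ∈ X, H.Encloses o c x) ∧ ∃ x ∈ X, ¬ H.Encloses o c x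

/-- The edge of `d` belongs to the interior of the cycle `s`, the subgraph formed by the edges
incident to a face enclosed by `s`. The edges of `s` itself belong to it. -/
def InInt (o : H.Face) (s : List D) (d : D) : Prop :=
  ∃ f, H.FaceIncEdge f d ∧ H.Encloses o s f

/-- The edge of `d` belongs to the exterior of the cycle `s`, the subgraph formed by the edges
incident to a face not enclosed by `s`. The edges of `s` itself belong to it. -/
def InExt (o : H.Face) (s : List D) (d : D) : Prop :=
  ∃ f, H.FaceIncEdge f d ∧ ¬ H.Encloses o s f

/-- The cycle `c` crosses the cycle `s`: it is contained neither in the interior of `s` nor in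
the exterior of `s`. -/
def Crosses (o : H.Face) (c s : List D) : Prop :=
  ¬ ((∀ d ∈ c, H.InInt o s d) ∨ ∀ d ∈ c, H.InExt o s d)

end RotationSystem

namespace RotationSystem

variable {D : Type*} (H : RotationSystem D)

/-! Let `Y` be the set of faces that `C` does not enclose; it contains a terminal `f`. The tree
paths forming `S*` (from the common ancestor in case (i), from the root in case (ii)) are geodesics
whose ends touch enclosed faces, that is, faces outside `Y`. If such a path has an edge with `Y` on
both sides, a piece of it is a chord of `Y`. The chord is no longer than either arc of the cycle
between its ends, so both cycles cut off by it are no longer than the given one. Keep the one whose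
side contains `f` (`exists_smaller_side`). Sides shrink strictly and faces outside stay outside, so
this stops (`exists_cycle_avoiding`).

In the end no edge of `S*` is interior to the final side `Y'`; for `e` this holds because `ve` is
outside. The faces of `Y'` are connected without crossing its boundary, so `Y'` lies on one side of
`S*`, and so does its boundary cycle (`exists_not_crosses`).

The planar topology is homology modulo two: Euler's formula and connectivity make every cycle a
coboundary of faces (`ker_boundary_eq_range_coboundary`), which yields the Jordan curve theorem
(`exists_bounds`, `eq_of_bounds`). -/

theorem sameCycle_iff_of_invariant {f : Equiv.Perm D} {p : D → Prop} (h : ∀ d, p d ↔ p (f d))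
    {d d' : D} (hd : f.SameCycle d d') : p d ↔ p d' := by
  obtain ⟨i, rfl⟩ := hd
  induction i using Int.induction_on with
  | zero => simp
  | succ n ih =>
    rw [ih, h, ← Equiv.Perm.mul_apply, ← zpow_one_add, add_comm]
  | pred n ih =>
    rw [ih, h ((f ^ (-(n : ℤ) - 1)) d), ← Equiv.Perm.mul_apply, ← zpow_one_add]
    congr! 3
    ring

theorem iff_of_tail_eq {p : D → Prop} (h : ∀ d, p d ↔ p (H.vnext d)) {d d' : D}
    (hd : H.tail d = H.tail d') : p d ↔ p d' :=
  sameCycle_iff_of_invariant h (Quotient.exact hd)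

@[simp] theorem edge_rev (d : D) : H.edge (H.rev d) = H.edge d :=
  Quotient.sound ⟨1, by simp [H.rev_rev]⟩

@[simp] theorem head_rev (d : D) : H.head (H.rev d) = H.tail d := by
  rw [head, H.rev_rev]

@[simp] theorem tail_rev (d : D) : H.tail (H.rev d) = H.head d := rfl

@[simp] theorem tail_vnext (d : D) : H.tail (H.vnext d) = H.tail d :=
  Quotient.sound ⟨-1, by simp⟩

/-- Darts consecutive around a vertex share the corner between them. This makes corner sums cancel
in pairs and lets a property of faces be carried around a vertex. -/
theorem face_vnext (d : D) : H.face (H.vnext d) = H.face (H.rev d) := by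
  refine Quotient.sound ⟨-1, ?_⟩
  rw [zpow_neg_one, Equiv.Perm.inv_eq_iff_eq, H.fnext_eq, H.rev_rev]

theorem edge_eq_edge_iff {d d' : D} : H.edge d = H.edge d' ↔ d = d' ∨ d = H.rev d' := by
  constructor
  · intro h
    have := sameCycle_iff_of_invariant (p := fun x => x = d' ∨ x = H.rev d') (f := H.rev)
      (fun x => ?_) (Quotient.exact h)
    · exact this.2 (Or.inl rfl)
    · constructor
      · rintro (rfl | rfl)
        · exact Or.inr rfl
        · exact Or.inl (H.rev_rev _)
      · rintro (h | h)
        · exact Or.inr (by rw [← h, H.rev_rev])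
        · exact Or.inl (H.rev.injective h)
  · rintro (rfl | rfl)
    · rfl
    · exact H.edge_rev _

instance [Finite D] : Finite H.Vertex := inferInstanceAs (Finite (Quotient _))
instance [Finite D] : Finite H.Edge := inferInstanceAs (Finite (Quotient _))
instance [Finite D] : Finite H.Face := inferInstanceAs (Finite (Quotient _))

theorem isWalk_append {u v : H.Vertex} {p q : List D} :
    H.IsWalk u (p ++ q) v ↔ ∃ x, H.IsWalk u p x ∧ H.IsWalk x q v := by
  induction p generalizing u with
  | nil => simp [IsWalk]
  | cons d p ih => simp [IsWalk, ih, and_assoc]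

theorem IsWalk.cons_map_head {u v : H.Vertex} {p : List D} (h : H.IsWalk u p v) :
    u :: p.map H.head = p.map H.tail ++ [v] := by
  induction p generalizing u with
  | nil => simpa [IsWalk] using h
  | cons d p ih => simp [← h.1, ih h.2]

theorem IsWalk.revWalk {u v : H.Vertex} {p : List D} (h : H.IsWalk u p v) :
    H.IsWalk v (H.revWalk p) u := by
  induction p generalizing u with
  | nil => exact Eq.symm h
  | cons d p ih =>
    simp only [RotationSystem.revWalk, List.map_cons, List.reverse_cons]
    exact H.isWalk_append.2 ⟨_, ih h.2, rfl, by simpa [IsWalk] using h.1⟩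

theorem map_edge_revWalk (p : List D) : (H.revWalk p).map H.edge = (p.map H.edge).reverse := by
  simp [revWalk, Function.comp_def]

theorem map_tail_revWalk (p : List D) : (H.revWalk p).map H.tail = (p.map H.head).reverse := by
  simp [revWalk, Function.comp_def]

theorem length_eq_sum_map_edge (w : H.Edge → ℝ≥0∞) (p : List D) :
    H.length w p = ((p.map H.edge).map w).sum := by
  simp [length, Function.comp_def]

theorem length_revWalk (w : H.Edge → ℝ≥0∞) (p : List D) :
    H.length w (H.revWalk p) = H.length w p := by
  rw [length_eq_sum_map_edge, length_eq_sum_map_edge, map_edge_revWalk, List.map_reverse,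
    List.sum_reverse]

theorem length_append (w : H.Edge → ℝ≥0∞) (p q : List D) :
    H.length w (p ++ q) = H.length w p + H.length w q := by
  simp [length]

theorem IsCycle.perm_heads {c : List D} (hc : H.IsCycle c) :
    (c.map H.head).Perm (c.map H.tail) := by
  obtain ⟨-, ⟨u, hu⟩, -⟩ := hc
  have h := hu.cons_map_head
  exact List.Perm.cons_inv (a := u) (h ▸ List.perm_append_singleton _ _)

/-! ### Chains modulo two -/

theorem chain_add_self {α : Type*} (A : α → ZMod 2) : A + A = 0 :=
  funext fun _ => CharTwo.add_self_eq_zero _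

/-- The coboundary modulo two of a set of faces: the edges between the set and its complement. -/
noncomputable def coboundary : (H.Face → ZMod 2) →ₗ[ZMod 2] (H.Edge → ZMod 2) where
  toFun k ε := k (H.face (Quotient.out ε)) + k (H.face (H.rev (Quotient.out ε)))
  map_add' k l := by
    ext ε
    simp only [Pi.add_apply]
    ring
  map_smul' a k := by
    ext ε
    simp [mul_add]

theorem coboundary_edge (k : H.Face → ZMod 2) (d : D) :
    H.coboundary k (H.edge d) = k (H.face d) + k (H.face (H.rev d)) := by
  have h : H.edge (Quotient.out (H.edge d)) = H.edge d := Quotient.out_eq _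
  change k (H.face (Quotient.out (H.edge d))) + k (H.face (H.rev (Quotient.out (H.edge d)))) = _
  rcases H.edge_eq_edge_iff.1 h with h | h <;> rw [h]
  rw [H.rev_rev, add_comm]

open Classical in
/-- The chain modulo two of the edges of a walk. -/
noncomputable def chain (p : List D) : H.Edge → ZMod 2 :=
  (p.map fun d => Pi.single (H.edge d) 1).sum

open Classical in
theorem chain_apply {p : List D} (hp : (p.map H.edge).Nodup) (ε : H.Edge) :
    H.chain p ε = if ε ∈ p.map H.edge then 1 else 0 := by
  induction p with
  | nil => simp [chain]
  | cons d p ih =>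
    rw [List.map_cons, List.nodup_cons] at hp
    have h := ih hp.2
    simp only [chain] at h
    simp only [chain, List.map_cons, List.sum_cons, Pi.add_apply, h, Pi.single_apply,
      List.mem_cons]
    by_cases hε : ε = H.edge d
    · subst hε
      simp [hp.1]
    · simp [hε]

section Chains

variable [Fintype D]

open Classical in
/-- The boundary of a one-chain modulo two. -/
noncomputable def boundary : (H.Edge → ZMod 2) →ₗ[ZMod 2] (H.Vertex → ZMod 2) where
  toFun A v := ∑ d, if H.tail d = v then A (H.edge d) else 0
  map_add' A B := by
    ext v
    simp only [Pi.add_apply, ← Finset.sum_add_distrib]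
    exact Finset.sum_congr rfl fun d _ => by split_ifs <;> simp
  map_smul' a A := by
    ext v
    simp [Finset.mul_sum]

/-- Every corner at `v` is counted twice, once from each of its two darts; reindexing by `vnext`
matches the two counts. -/
theorem boundary_coboundary (k : H.Face → ZMod 2) : H.boundary (H.coboundary k) = 0 := by
  classical
  ext v
  change (∑ d, if H.tail d = v then H.coboundary k (H.edge d) else 0) = 0
  have h : ∀ d, (if H.tail d = v then H.coboundary k (H.edge d) else 0) =
      (if H.tail d = v then k (H.face d) else 0) +
        (if H.tail (H.vnext d) = v then k (H.face (H.vnext d)) else 0) := by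
    intro d
    rw [H.coboundary_edge, H.tail_vnext, H.face_vnext]
    split_ifs <;> simp
  rw [Finset.sum_congr rfl fun d _ => h d, Finset.sum_add_distrib,
    Equiv.sum_comp H.vnext (fun d => if H.tail d = v then k (H.face d) else 0)]
  exact CharTwo.add_self_eq_zero _

open Classical in
theorem boundary_single_edge (d : D) :
    H.boundary (Pi.single (H.edge d) 1) =
      Pi.single (H.tail d) 1 + Pi.single (H.head d) 1 := by
  ext v
  change (∑ d', if H.tail d' = v then
    (Pi.single (H.edge d) 1 : H.Edge → ZMod 2) (H.edge d') else 0) = _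
  rw [← Finset.sum_subset (Finset.subset_univ {d, H.rev d}),
    Finset.sum_pair (H.rev_ne d).symm]
  · simp [Pi.single_apply, eq_comm]
  · intro d' _ hd'
    have : H.edge d' ≠ H.edge d := fun h => hd' (by simpa using H.edge_eq_edge_iff.1 h)
    simp [this]

open Classical in
theorem IsWalk.boundary_chain {u v : H.Vertex} {p : List D} (h : H.IsWalk u p v) :
    H.boundary (H.chain p) = Pi.single u 1 + Pi.single v 1 := by
  induction p generalizing u with
  | nil =>
    obtain rfl : u = v := h
    simp [chain, chain_add_self]
  | cons d p ih =>
    have h' := ih h.2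
    simp only [chain] at h'
    simp only [chain, List.map_cons, List.sum_cons, map_add, h', boundary_single_edge, h.1]
    rw [add_assoc, ← add_assoc (Pi.single (H.head d) 1), chain_add_self, zero_add]

/-- A dimension count: the kernel has dimension at most E - V + 1, which is F - 1 by Euler's
formula, and the range has dimension at least F - 1. -/
theorem ker_boundary_eq_range_coboundary (hconn : ∀ u v : H.Vertex, ∃ p, H.IsWalk u p v)
    (hdual : ∀ f g : H.dual.Vertex, ∃ p, H.dual.IsWalk f p g)
    (heuler : Nat.card H.Vertex + Nat.card H.Face = Nat.card H.Edge + 2) :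
    LinearMap.ker H.boundary = LinearMap.range H.coboundary := by
  classical
  have := Fintype.ofFinite H.Vertex
  have := Fintype.ofFinite H.Edge
  have := Fintype.ofFinite H.Face
  simp only [Nat.card_eq_fintype_card] at heuler
  have hle : LinearMap.range H.coboundary ≤ LinearMap.ker H.boundary := by
    rintro _ ⟨k, rfl⟩
    exact H.boundary_coboundary k
  refine (Submodule.eq_of_le_of_finrank_le hle ?_).symm
  have h1 := LinearMap.finrank_range_add_finrank_ker H.boundary
  have h2 := LinearMap.finrank_range_add_finrank_ker H.coboundary
  rw [Module.finrank_fintype_fun_eq_card] at h1 h2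
  -- A function in the kernel agrees across every edge, so it is constant by dual connectivity.
  have h3 : Module.finrank (ZMod 2) (LinearMap.ker H.coboundary) ≤ 1 := by
    have : LinearMap.ker H.coboundary ≤ Submodule.span (ZMod 2) {fun _ => 1} := by
      intro k hk
      have hstep : ∀ d, k (H.face d) = k (H.face (H.rev d)) := by
        intro d
        have := congrFun (LinearMap.mem_ker.1 hk) (H.edge d)
        rw [H.coboundary_edge] at this
        exact CharTwo.add_eq_zero.1 this
      have hwalk : ∀ (p : List D) (f g : H.dual.Vertex), H.dual.IsWalk f p g →
          k f = k g := by
        intro p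
        induction p with
        | nil => rintro f _ rfl; rfl
        | cons d p ih =>
          rintro f g ⟨rfl, h⟩
          exact (hstep d).trans (ih _ _ h)
      rw [Submodule.mem_span_singleton]
      rcases isEmpty_or_nonempty H.Face with hF | ⟨⟨f⟩⟩
      · exact ⟨0, Subsingleton.elim _ _⟩
      · refine ⟨k f, ?_⟩
        ext g
        obtain ⟨p, hp⟩ := hdual f g
        simpa using hwalk p f g hp
    exact (Submodule.finrank_mono this).trans ((finrank_span_le_card _).trans (by simp))
  -- A walk from `u` to `v` shows that every vertex is a boundary modulo one fixed vertex.
  have h4 : Fintype.card H.Vertex ≤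
      Module.finrank (ZMod 2) (LinearMap.range H.boundary) + 1 := by
    rcases isEmpty_or_nonempty H.Vertex with hV | ⟨⟨v⟩⟩
    · simp
    have htop : LinearMap.range H.boundary ⊔
        Submodule.span (ZMod 2) {(Pi.single v 1 : H.Vertex → ZMod 2)} = ⊤ := by
      rw [eq_top_iff, ← (Pi.basisFun (ZMod 2) H.Vertex).span_eq, Submodule.span_le]
      rintro _ ⟨u, rfl⟩
      obtain ⟨p, hp⟩ := hconn u v
      rw [Pi.basisFun_apply]
      have : (Pi.single u 1 : H.Vertex → ZMod 2) =
          H.boundary (H.chain p) + Pi.single v 1 := by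
        rw [hp.boundary_chain, add_assoc, chain_add_self, add_zero]
      rw [this]
      exact Submodule.add_mem_sup (LinearMap.mem_range_self _ _)
        (Submodule.mem_span_singleton_self _)
    have h5 := Submodule.finrank_add_le_finrank_add_finrank (LinearMap.range H.boundary)
      (Submodule.span (ZMod 2) {(Pi.single v 1 : H.Vertex → ZMod 2)})
    rw [htop, finrank_top, Module.finrank_fintype_fun_eq_card] at h5
    exact h5.trans (Nat.add_le_add_left ((finrank_span_le_card _).trans (by simp)) _)
  omega

end Chains

/-! ### The Jordan curve theorem: the two sides of a simple cycle -/

/-- Vertices and faces are connected through the edges, and Euler's formula holds. -/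
structure IsSpherical : Prop where
  connected : ∀ u v : H.Vertex, ∃ p, H.IsWalk u p v
  dual_connected : ∀ f g : H.dual.Vertex, ∃ p, H.dual.IsWalk f p g
  euler : Nat.card H.Vertex + Nat.card H.Face = Nat.card H.Edge + 2

/-- The dart `d` has the same membership in the set of faces `Z` on both sides. -/
def SameSide (Z : Set H.Face) (d : D) : Prop := H.face d ∈ Z ↔ H.face (H.rev d) ∈ Z

/-- The edges of `c` are exactly the edges between the set of faces `Y` and its complement. -/
def Bounds (Y : Set H.Face) (c : List D) : Prop :=
  ∀ d, H.edge d ∈ c.map H.edge ↔ ¬ H.SameSide Y d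

variable {H}

theorem Bounds.compl {Y : Set H.Face} {c : List D} (h : H.Bounds Y c) : H.Bounds Yᶜ c := by
  intro d
  rw [h d, SameSide, SameSide, Set.mem_compl_iff, Set.mem_compl_iff,
    @not_iff_not (H.face d ∈ Y)]

theorem Bounds.of_edges {Y : Set H.Face} {c c' : List D} (h : H.Bounds Y c)
    (hc : ∀ ε, ε ∈ c'.map H.edge ↔ ε ∈ c.map H.edge) : H.Bounds Y c' :=
  fun d => (hc _).trans (h d)

/-- The chain of a closed walk has zero boundary, hence is the coboundary of some `k`; the support
of `k` is a side. -/
theorem IsSpherical.exists_bounds [Finite D] (hH : H.IsSpherical) {u : H.Vertex} {c : List D}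
    (hc : H.IsWalk u c u) (hn : (c.map H.edge).Nodup) : ∃ Y, H.Bounds Y c := by
  classical
  have := Fintype.ofFinite D
  have hk : H.chain c ∈ LinearMap.ker H.boundary := by
    rw [LinearMap.mem_ker, hc.boundary_chain, chain_add_self]
  rw [H.ker_boundary_eq_range_coboundary hH.1 hH.2 hH.3] at hk
  obtain ⟨k, hk⟩ := hk
  refine ⟨{f | k f = 1}, fun d => ?_⟩
  have h := congrFun hk (H.edge d)
  rw [H.coboundary_edge, H.chain_apply hn] at h
  have key : ∀ a b : ZMod 2, ∀ P : Prop, a + b = (if P then 1 else 0) →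
      (P ↔ ¬ (a = 1 ↔ b = 1)) := by
    intro a b P
    by_cases hP : P <;> simp only [hP, if_true, if_false] <;> revert a b <;> decide
  exact key _ _ _ (h.trans (by congr))

theorem IsSpherical.eq_empty_or_univ (hH : H.IsSpherical) {Z : Set H.Face}
    (hZ : ∀ d, H.SameSide Z d) : Z = ∅ ∨ Z = Set.univ := by
  have hwalk : ∀ (p : List D) (f g : H.dual.Vertex), H.dual.IsWalk f p g →
      ((f : H.Face) ∈ Z ↔ (g : H.Face) ∈ Z) := by
    intro p
    induction p with
    | nil => rintro f _ rfl; rfl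
    | cons d p ih =>
      rintro f g ⟨rfl, h⟩
      exact (hZ d).trans (ih _ _ h)
  rcases Z.eq_empty_or_nonempty with h | ⟨f, hf⟩
  · exact Or.inl h
  · refine Or.inr (Set.eq_univ_of_forall fun g => ?_)
    obtain ⟨p, hp⟩ := hH.2 f g
    exact (hwalk p f g hp).1 hf

/-- The coboundary of the indicator of `Z` is supported on `c` and has zero boundary. Only two darts
at a vertex of a simple cycle belong to it, so consecutive edges carry equal values. -/
theorem IsCycle.sameSide_iff [Finite D] {c : List D} (hc : H.IsCycle c) {Z : Set H.Face}
    (hZ : ∀ d, H.edge d ∉ c.map H.edge → H.SameSide Z d) :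
    ∀ a ∈ c, ∀ b ∈ c, (H.SameSide Z a ↔ H.SameSide Z b) := by
  classical
  have := Fintype.ofFinite D
  let k : H.Face → ZMod 2 := fun f => if f ∈ Z then 1 else 0
  have hk : ∀ d, H.coboundary k (H.edge d) = 0 ↔ H.SameSide Z d := by
    intro d
    rw [H.coboundary_edge, SameSide]
    by_cases h1 : H.face d ∈ Z <;> by_cases h2 : H.face (H.rev d) ∈ Z <;>
      simp [k, h1, h2, CharTwo.add_self_eq_zero]
  have htail := List.inj_on_of_nodup_map hc.2.2.1
  have hhead := List.inj_on_of_nodup_map (hc.perm_heads.nodup_iff.2 hc.2.2.1)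
  have step : ∀ l₁ d d' l₂, c = l₁ ++ d :: d' :: l₂ →
      (H.SameSide Z d ↔ H.SameSide Z d') := by
    intro l₁ d d' l₂ hl
    have hd : d ∈ c := by simp [hl]
    have hd' : d' ∈ c := by simp [hl]
    have hne : H.edge d ≠ H.edge d' := by
      have := hc.2.2.2
      rw [hl, List.map_append, List.nodup_append] at this
      have := this.2.1
      simp only [List.map_cons, List.nodup_cons, List.mem_cons, not_or] at this
      exact this.1.1
    have hv : H.tail d' = H.head d := by
      obtain ⟨u, hu⟩ := hc.2.1
      rw [hl, isWalk_append] at hu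
      obtain ⟨x, -, hx⟩ := hu
      exact hx.2.1
    have hsum := congrFun (H.boundary_coboundary k) (H.head d)
    change (∑ z, if H.tail z = H.head d then H.coboundary k (H.edge z) else 0) = 0 at hsum
    have hne' : H.rev d ≠ d' := fun h => hne (by rw [← h, edge_rev])
    rw [← Finset.sum_subset (Finset.subset_univ {H.rev d, d'}), Finset.sum_pair hne'] at hsum
    · rw [tail_rev, if_pos rfl, if_pos hv, edge_rev] at hsum
      rw [← hk, ← hk, CharTwo.add_eq_zero.1 hsum]
    · intro z _ hz
      rw [Finset.mem_insert, Finset.mem_singleton, not_or] at hz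
      split_ifs with hzv
      · rw [hk]
        refine hZ z fun hzc => ?_
        obtain ⟨y, hy, hyz⟩ := List.mem_map.1 hzc
        rcases H.edge_eq_edge_iff.1 hyz with rfl | rfl
        · exact hz.2 (htail hy hd' (hzv.trans hv.symm))
        · exact hz.1 (by rw [← hhead hy hd ((H.head_rev z).trans hzv), H.rev_rev])
      · rfl
  have main : ∀ l₂ l₁, c = l₁ ++ l₂ →
      ∀ a ∈ l₂, ∀ b ∈ l₂, (H.SameSide Z a ↔ H.SameSide Z b) := by
    intro l₂
    induction l₂ with
    | nil => simp
    | cons d l ih =>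
      intro l₁ hl
      have ih' := ih (l₁ ++ [d]) (by simp [hl])
      have hd : ∀ b ∈ l, (H.SameSide Z d ↔ H.SameSide Z b) := by
        intro b hb
        cases l with
        | nil => simp at hb
        | cons d' l => exact (step l₁ d d' l hl).trans (ih' d' (by simp) b hb)
      intro a ha b hb
      rcases List.mem_cons.1 ha with ha | ha <;> rcases List.mem_cons.1 hb with hb | hb
      · rw [ha, hb]
      · exact ha ▸ hd b hb
      · exact hb ▸ (hd a ha).symm
      · exact ih' a ha b hb
  exact main c [] rfl

/-- This says that each side of a simple cycle is connected: a set that jumps only along `c` jumps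
on all of `c` or nowhere. -/
theorem IsSpherical.eq_of_bounds [Finite D] (hH : H.IsSpherical) {c : List D} (hc : H.IsCycle c)
    {Y Z : Set H.Face} (hY : H.Bounds Y c)
    (hZ : ∀ d, H.edge d ∉ c.map H.edge → H.SameSide Z d) :
    Z = ∅ ∨ Z = Set.univ ∨ Z = Y ∨ Z = Yᶜ := by
  have hedge : ∀ {W : Set H.Face} {d y : D}, H.edge y = H.edge d →
      (H.SameSide W y ↔ H.SameSide W d) := by
    intro W d y h
    rcases H.edge_eq_edge_iff.1 h with rfl | rfl
    · rfl
    · rw [SameSide, SameSide, H.rev_rev]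
      exact Iff.comm
  by_cases h : ∀ d ∈ c, H.SameSide Z d
  · rcases hH.eq_empty_or_univ (Z := Z) fun d => by
      by_cases hd : H.edge d ∈ c.map H.edge
      · obtain ⟨y, hy, hyd⟩ := List.mem_map.1 hd
        exact (hedge hyd).1 (h y hy)
      · exact hZ d hd with h | h
    · exact Or.inl h
    · exact Or.inr (Or.inl h)
  · push Not at h
    obtain ⟨a, ha, haZ⟩ := h
    have hall : ∀ d, H.edge d ∈ c.map H.edge → ¬ H.SameSide Z d := by
      intro d hd
      obtain ⟨y, hy, hyd⟩ := List.mem_map.1 hd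
      rw [← hedge hyd, hc.sameSide_iff hZ y hy a ha]
      exact haZ
    right; right
    -- When `Z` jumps on all of `c`, it jumps exactly where `Y` does, so whether they agree is the
    -- same for all faces.
    rcases hH.eq_empty_or_univ (Z := {f | f ∈ Z ↔ f ∈ Y}) fun d => by
      have h1 := hY d
      have h2 := hZ d
      have h3 := hall d
      simp only [SameSide, Set.mem_ofPred_eq] at *
      tauto with h | h
    · right
      ext f
      have : f ∉ {f | f ∈ Z ↔ f ∈ Y} := by rw [h]; exact Set.notMem_empty _
      simp only [Set.mem_ofPred_eq] at this
      rw [Set.mem_compl_iff]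
      tauto
    · left
      ext f
      have : f ∈ {f | f ∈ Z ↔ f ∈ Y} := by rw [h]; trivial
      exact this

theorem IsSpherical.encloses_iff [Finite D] (hH : H.IsSpherical) {c : List D} (hc : H.IsCycle c)
    {Y : Set H.Face} (hY : H.Bounds Y c) (o f : H.Face) :
    H.Encloses o c f ↔ ¬ (f ∈ Y ↔ o ∈ Y) := by
  rw [Encloses, not_iff_not]
  constructor
  · intro h
    induction h with
    | refl => rfl
    | tail _ h ih =>
      obtain ⟨d, hd, rfl, rfl⟩ := h
      exact ih.trans (not_not.1 fun h => hd ((hY d).2 h))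
  · intro h
    have hZ := hH.eq_of_bounds hc hY
      (Z := {f | Relation.ReflTransGen (H.FaceStep c) f o}) fun d hd => by
        refine ⟨fun h => .head ⟨H.rev d, ?_, rfl, ?_⟩ h, fun h => .head ⟨d, hd, rfl, rfl⟩ h⟩
        · rwa [edge_rev]
        · rw [H.rev_rev]
    have ho : o ∈ {f | Relation.ReflTransGen (H.FaceStep c) f o} :=
      Relation.ReflTransGen.refl
    change f ∈ {f | Relation.ReflTransGen (H.FaceStep c) f o}
    rcases hZ with e | e | e | e <;> rw [e] at ho ⊢
    · exact ho
    · trivial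
    · exact h.2 ho
    · exact fun hf => ho (h.1 hf)

/-- The condition is symmetric in the two sides, so it does not matter which of them contains `o`;
cutting along chords may move `o` to the other side. -/
theorem IsSpherical.terminalSeparating_iff [Finite D] (hH : H.IsSpherical) {c : List D}
    (hc : H.IsCycle c) {Y : Set H.Face} (hY : H.Bounds Y c) (o : H.Face) (X : Set H.Face) :
    H.TerminalSeparating o X c ↔ ∃ x ∈ X, ∃ t ∈ X, x ∈ Y ∧ t ∉ Y := by
  simp only [TerminalSeparating, hH.encloses_iff hc hY]
  constructor
  · rintro ⟨⟨x, hx, hxo⟩, ⟨t, ht, hto⟩⟩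
    by_cases h : x ∈ Y
    · exact ⟨x, hx, t, ht, h, by tauto⟩
    · exact ⟨t, ht, x, hx, by tauto, h⟩
  · rintro ⟨x, hx, t, ht, hxY, htY⟩
    by_cases h : o ∈ Y
    · exact ⟨⟨t, ht, by tauto⟩, x, hx, by tauto⟩
    · exact ⟨⟨x, hx, by tauto⟩, t, ht, by tauto⟩

/-! ### Walks inside a side, and chords -/

theorem IsWalk.mem_cons_heads {u v : H.Vertex} {p : List D} (h : H.IsWalk u p v) {x : H.Vertex}
    (hx : x ∈ p.map H.tail) : x ∈ u :: p.map H.head := by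
  rw [h.cons_map_head]
  exact List.mem_append_left _ hx

theorem IsPath.nodup_edges {u v : H.Vertex} {p : List D} (h : H.IsPath u p v) :
    (p.map H.edge).Nodup := by
  obtain ⟨h, hn⟩ := h
  induction p generalizing u with
  | nil => simp
  | cons d p ih =>
    rw [List.map_cons, List.nodup_cons] at hn
    rw [List.map_cons, List.nodup_cons]
    refine ⟨fun hd => hn.1 ?_, ih h.2 hn.2⟩
    obtain ⟨d', hd', he⟩ := List.mem_map.1 hd
    rw [← h.1]
    rcases H.edge_eq_edge_iff.1 he with rfl | rfl
    · exact h.2.mem_cons_heads (List.mem_map_of_mem hd')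
    · exact List.mem_cons_of_mem _ (by simpa using List.mem_map_of_mem (f := H.head) hd')

theorem IsPath.infix {a b x y : H.Vertex} {p q s : List D} {d : D}
    (h : H.IsPath a (p ++ d :: q ++ s) b) (hx : H.IsWalk x (d :: q) y) :
    H.IsPath x (d :: q) y := by
  refine ⟨hx, ?_⟩
  obtain ⟨h, hn⟩ := h
  rw [List.append_assoc, isWalk_append] at h
  obtain ⟨x', hp, hx'⟩ := h
  have hxx : x' = x := hx'.1.symm.trans hx.1
  subst hxx
  rw [List.append_assoc, List.map_append, ← List.cons_append, hp.cons_map_head, List.append_assoc,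
    List.nodup_append', List.singleton_append, List.map_append, ← List.cons_append,
    List.nodup_append'] at hn
  exact hn.2.1.1

theorem IsCycle.tail_mem {c : List D} (hc : H.IsCycle c) {d : D}
    (hd : H.edge d ∈ c.map H.edge) : H.tail d ∈ c.map H.tail := by
  obtain ⟨y, hy, hyd⟩ := List.mem_map.1 hd
  rcases H.edge_eq_edge_iff.1 hyd with rfl | rfl
  · exact List.mem_map_of_mem hy
  · rw [← hc.perm_heads.mem_iff, ← H.head_rev d]
    exact List.mem_map_of_mem hy

/-- Turning around the vertex from a face in `Y` to one outside must pass an edge of `c`. -/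
theorem IsCycle.tail_mem_of_faces {c : List D} (hc : H.IsCycle c) {Y : Set H.Face}
    (hY : H.Bounds Y c) {a b : D} (hab : H.tail a = H.tail b) (ha : H.face a ∈ Y)
    (hb : H.face b ∉ Y) : H.tail a ∈ c.map H.tail := by
  by_contra h
  -- The guard on the tail makes the property vacuous at other vertices, so it is invariant under
  -- `vnext` everywhere.
  refine hb ((H.iff_of_tail_eq (p := fun d => H.tail d = H.tail a → H.face d ∈ Y) (fun d => ?_)
    hab).1 (fun _ => ha) hab.symm)
  rw [H.tail_vnext, H.face_vnext]
  refine forall_congr' fun hd => ?_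
  by_contra hs
  exact h (hd ▸ hc.tail_mem ((hY d).2 hs))

/-- Stop at the first vertex on `c`: before it, all corners at the visited vertices lie in `Y`. -/
theorem IsCycle.exists_prefix {c : List D} (hc : H.IsCycle c) {Y : Set H.Face}
    (hY : H.Bounds Y c) {v b : H.Vertex} {p : List D} (hp : H.IsWalk v p b)
    (hv : ∃ d, H.tail d = v ∧ H.face d ∈ Y) (hb : ∃ d, H.tail d = b ∧ H.face d ∉ Y) :
    ∃ q s y, p = q ++ s ∧ H.IsWalk v q y ∧ y ∈ c.map H.tail ∧
      (∀ d ∈ q, H.face d ∈ Y ∧ H.face (H.rev d) ∈ Y) ∧ ∀ d ∈ q, H.tail d ∉ c.map H.tail := by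
  induction p generalizing v with
  | nil =>
    obtain rfl : v = b := hp
    obtain ⟨d, rfl, hd⟩ := hv
    obtain ⟨d', hdd, hd'⟩ := hb
    exact ⟨[], [], _, rfl, rfl, hc.tail_mem_of_faces hY hdd.symm hd hd', by simp, by simp⟩
  | cons d p ih =>
    by_cases hvc : v ∈ c.map H.tail
    · exact ⟨[], d :: p, v, rfl, rfl, hvc, by simp, by simp⟩
    obtain ⟨d₀, hd₀, hd₀Y⟩ := hv
    have hd : H.face d ∈ Y := by
      by_contra hd
      exact hvc (hd₀ ▸ hc.tail_mem_of_faces hY (hd₀.trans hp.1.symm) hd₀Y hd)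
    have hd' : H.face (H.rev d) ∈ Y := by
      by_contra hd'
      exact hvc (hp.1 ▸ hc.tail_mem ((hY d).2 fun h => hd' (h.1 hd)))
    obtain ⟨q, s, y, rfl, hq, hy, hqY, hqc⟩ := ih hp.2 ⟨H.rev d, rfl, hd'⟩
    refine ⟨d :: q, s, y, rfl, ⟨hp.1, hq⟩, hy, ?_, ?_⟩
    · simpa [hd, hd'] using hqY
    · intro z hz
      rcases List.mem_cons.1 hz with rfl | hz
      · rwa [hp.1]
      · exact hqc z hz

/-- A walk that starts and ends at faces outside `Y` and uses an edge in the interior of `Y` contains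
a chord of `Y`. -/
theorem IsCycle.exists_chord {c : List D} (hc : H.IsCycle c) {Y : Set H.Face}
    (hY : H.Bounds Y c) {a b : H.Vertex} {P : List D} (hP : H.IsWalk a P b)
    (ha : ∃ d, H.tail d = a ∧ H.face d ∉ Y) (hb : ∃ d, H.tail d = b ∧ H.face d ∉ Y)
    (hd : ∃ d ∈ P, H.face d ∈ Y ∧ H.face (H.rev d) ∈ Y) :
    ∃ p d q s x y, P = p ++ d :: q ++ s ∧ H.IsWalk x (d :: q) y ∧ x ∈ c.map H.tail ∧
      y ∈ c.map H.tail ∧ (∀ z ∈ d :: q, H.face z ∈ Y ∧ H.face (H.rev z) ∈ Y) ∧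
      ∀ z ∈ q, H.tail z ∉ c.map H.tail := by
  induction P generalizing a with
  | nil => simp at hd
  | cons d P ih =>
    by_cases hdY : H.face d ∈ Y ∧ H.face (H.rev d) ∈ Y
    · obtain ⟨q, s, y, rfl, hq, hy, hqY, hqc⟩ := hc.exists_prefix hY hP.2 ⟨H.rev d, rfl, hdY.2⟩ hb
      obtain ⟨d₀, hd₀, hd₀Y⟩ := ha
      refine ⟨[], d, q, s, a, y, rfl, ⟨hP.1, hq⟩, ?_, hy, ?_, hqc⟩
      · exact hP.1 ▸ hc.tail_mem_of_faces hY (hP.1.trans hd₀.symm) hdY.1 hd₀Y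
      · intro z hz
        rcases List.mem_cons.1 hz with rfl | hz
        · exact hdY
        · exact hqY z hz
    · have hhead : ∃ d', H.tail d' = H.head d ∧ H.face d' ∉ Y := by
        by_cases h : H.face (H.rev d) ∈ Y
        · refine ⟨H.vnext (H.rev d), by simp, ?_⟩
          rw [H.face_vnext, H.rev_rev]
          exact fun h' => hdY ⟨h', h⟩
        · exact ⟨H.rev d, rfl, h⟩
      obtain ⟨d', hd', hd'Y⟩ := hd
      rcases List.mem_cons.1 hd' with rfl | hd'
      · exact absurd hd'Y hdY
      obtain ⟨p, e, q, s, x, y, rfl, h⟩ := ih hP.2 hhead ⟨d', hd', hd'Y⟩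
      exact ⟨d :: p, e, q, s, x, y, rfl, h⟩

theorem IsCycle.exists_perm {c : List D} (hc : H.IsCycle c) {x : H.Vertex}
    (hx : x ∈ c.map H.tail) : ∃ c', c'.Perm c ∧ H.IsCycle c' ∧ H.IsWalk x c' x := by
  obtain ⟨z, hz, rfl⟩ := List.mem_map.1 hx
  obtain ⟨l₁, l₂, rfl⟩ := List.append_of_mem hz
  obtain ⟨hne, ⟨u, hu⟩, ht, he⟩ := hc
  obtain ⟨m, h₁, h₂⟩ := H.isWalk_append.1 hu
  have hm : H.tail z = m := h₂.1
  have hperm : (z :: l₂ ++ l₁).Perm (l₁ ++ z :: l₂) := List.perm_append_comm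
  have hw : H.IsWalk (H.tail z) (z :: l₂ ++ l₁) (H.tail z) :=
    hm ▸ H.isWalk_append.2 ⟨u, h₂, h₁⟩
  exact ⟨_, hperm, ⟨by simp, ⟨_, hw⟩, (hperm.map _).nodup_iff.2 ht, (hperm.map _).nodup_iff.2 he⟩,
    hw⟩

/-! ### Geodesics and cutting along a chord -/

/-- A path all of whose subwalks are shortest walks. -/
def IsGeodesic (H : RotationSystem D) (w : H.Edge → ℝ≥0∞) (a : H.Vertex) (P : List D)
    (b : H.Vertex) : Prop :=
  H.IsPath a P b ∧ ∀ p q s x y q', P = p ++ q ++ s → H.IsWalk x q y → H.IsWalk x q' y →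
    H.length w q ≤ H.length w q'

/-- Modulo two the common arc `k₂` cancels, and for `Y₁ ⊆ Y` the symmetric difference is the
difference. -/
theorem Bounds.diff {Y Y₁ : Set H.Face} {g k₁ k₂ : List D} (hY : H.Bounds Y (k₁ ++ k₂))
    (hY₁ : H.Bounds Y₁ (g ++ k₂)) (hsub : Y₁ ⊆ Y)
    (hg : ∀ ε ∈ g.map H.edge, ε ∉ k₁.map H.edge ∧ ε ∉ k₂.map H.edge)
    (hk : (k₁.map H.edge).Disjoint (k₂.map H.edge)) :
    H.Bounds (Y \ Y₁) (H.revWalk g ++ k₁) := by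
  intro e
  have h1 := hY e
  have h2 := hY₁ e
  have h3 := hg (H.edge e)
  have h4 := @hk (H.edge e)
  have h5 := @hsub (H.face e)
  have h6 := @hsub (H.face (H.rev e))
  rw [List.map_append, List.mem_append] at h1 h2 ⊢
  rw [map_edge_revWalk, List.mem_reverse]
  simp only [SameSide, Set.mem_sdiff] at *
  clear hY hY₁ hsub hg hk
  grind

/-- Cutting a side of a cycle along a chord that is a shortest path. -/
theorem IsSpherical.exists_smaller_side [Finite D] (hH : H.IsSpherical) {w : H.Edge → ℝ≥0∞}
    {c : List D} (hc : H.IsCycle c) {Y : Set H.Face} (hY : H.Bounds Y c) {f : H.Face}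
    (hf : f ∈ Y) {a b : H.Vertex} {P : List D} (hP : H.IsGeodesic w a P b)
    (ha : ∃ d, H.tail d = a ∧ H.face d ∉ Y) (hb : ∃ d, H.tail d = b ∧ H.face d ∉ Y)
    (hd : ∃ d ∈ P, H.face d ∈ Y ∧ H.face (H.rev d) ∈ Y) :
    ∃ c' Y', H.IsCycle c' ∧ H.Bounds Y' c' ∧ f ∈ Y' ∧ Y' ⊂ Y ∧
      H.length w c' ≤ H.length w c := by
  obtain ⟨p, d, q, s, x, y, rfl, hg, hx, hy, hgY, hqc⟩ := hc.exists_chord hY hP.1.1 ha hb hd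
  have hgp := hP.1.infix hg
  obtain ⟨c', hperm, hc', hxc⟩ := hc.exists_perm hx
  have hmemT : ∀ v, v ∈ c.map H.tail ↔ v ∈ c'.map H.tail := fun v => (hperm.map _).mem_iff.symm
  have hlen : H.length w c = H.length w c' := (hperm.map _).sum_eq.symm
  replace hY := hY.of_edges (c' := c') fun ε => (hperm.map _).mem_iff
  rw [hlen]
  simp only [hmemT] at hy hqc
  clear hx hlen hmemT hc hperm c
  have hxd : H.tail d = x := hg.1
  have hheads : (d :: q).map H.head = q.map H.tail ++ [y] := by
    have := hg.cons_map_head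
    rw [List.map_cons (f := H.tail), hxd, List.cons_append] at this
    exact List.tail_eq_of_cons_eq this
  have hgn := hgp.2
  rw [hheads, List.nodup_cons, List.nodup_append'] at hgn
  have hxy : x ≠ y := fun h => hgn.1 (by simp [h])
  have hxq : x ∉ q.map H.tail := fun h => hgn.1 (List.mem_append_left _ h)
  obtain ⟨z, hz, rfl⟩ := List.mem_map.1 hy
  obtain ⟨c₁, c₂, rfl⟩ := List.append_of_mem hz
  obtain ⟨m, hc₁, hc₂⟩ := H.isWalk_append.1 hxc
  obtain rfl : H.tail z = m := hc₂.1
  obtain ⟨z₁, c₁', rfl⟩ : ∃ z₁ c₁', c₁ = z₁ :: c₁' := by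
    cases c₁ with
    | nil => exact absurd hc₁ hxy
    | cons z₁ c₁' => exact ⟨_, _, rfl⟩
  have hz₁ : H.tail z₁ = x := hc₁.1
  generalize hk₁ : z₁ :: c₁' = k₁ at *
  generalize hk₂ : z :: c₂ = k₂ at *
  have hxk₁ : x ∈ k₁.map H.tail := by rw [← hk₁, ← hz₁]; simp
  have hyk₂ : H.tail z ∈ k₂.map H.tail := by rw [← hk₂]; simp
  obtain ⟨-, -, hct, hce⟩ := id hc'
  rw [List.map_append, List.nodup_append'] at hct hce
  have hqk : ∀ v, v ∈ q.map H.tail → v ∉ k₁.map H.tail ∧ v ∉ k₂.map H.tail := by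
    intro v hv
    obtain ⟨z', hz', rfl⟩ := List.mem_map.1 hv
    have := hqc z' hz'
    rwa [List.map_append, List.mem_append, not_or] at this
  have hge : ∀ ε, ε ∈ (d :: q).map H.edge → ε ∉ k₁.map H.edge ∧ ε ∉ k₂.map H.edge := by
    intro ε hε
    obtain ⟨z', hz', rfl⟩ := List.mem_map.1 hε
    have := (hY z').not.2 (not_not.2 ⟨fun _ => (hgY z' hz').2, fun _ => (hgY z' hz').1⟩)
    rwa [List.map_append, List.mem_append, not_or] at this
  have hcA : H.IsCycle (d :: q ++ k₂) := by
    refine ⟨by simp, ⟨x, H.isWalk_append.2 ⟨_, hg, hc₂⟩⟩, ?_, ?_⟩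
    · rw [List.map_append, List.nodup_append', List.map_cons, hxd, List.nodup_cons]
      refine ⟨⟨hxq, hgn.2.1⟩, hct.2.1, fun v hv => ?_⟩
      rcases List.mem_cons.1 hv with rfl | hv
      · exact fun h => hct.2.2 hxk₁ h
      · exact (hqk v hv).2
    · rw [List.map_append, List.nodup_append']
      exact ⟨hgp.nodup_edges, hce.2.1, fun ε hε => (hge ε hε).2⟩
  have hcB : H.IsCycle (H.revWalk (d :: q) ++ k₁) := by
    refine ⟨by simp [revWalk], ⟨_, H.isWalk_append.2 ⟨_, hg.revWalk, hc₁⟩⟩, ?_, ?_⟩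
    · rw [List.map_append, List.nodup_append', map_tail_revWalk, List.nodup_reverse, hheads,
        List.nodup_append']
      refine ⟨hgn.2, hct.1, fun v hv => ?_⟩
      rw [List.mem_reverse, List.mem_append, List.mem_singleton] at hv
      rcases hv with hv | rfl
      · exact (hqk v hv).1
      · exact fun h => hct.2.2 h hyk₂
    · rw [List.map_append, List.nodup_append', map_edge_revWalk, List.nodup_reverse]
      exact ⟨hgp.nodup_edges, hce.1, fun ε hε => (hge ε (List.mem_reverse.1 hε)).1⟩
  -- The geodesic chord replaces the arc `k₁` here and the arc `k₂` in `hlB`.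
  have hlA : H.length w (d :: q ++ k₂) ≤ H.length w (k₁ ++ k₂) := by
    rw [length_append, length_append]
    gcongr
    exact hP.2 _ _ _ _ _ _ rfl hg hc₁
  have hlB : H.length w (H.revWalk (d :: q) ++ k₁) ≤ H.length w (k₁ ++ k₂) := by
    rw [length_append, length_append, length_revWalk, add_comm]
    gcongr
    rw [← H.length_revWalk w k₂]
    exact hP.2 _ _ _ _ _ _ rfl hg hc₂.revWalk
  -- For either side `Y₁` of the new cycle, `Y₁ \ Y` jumps only along the old cycle and omits `f`.
  -- So it is empty, or it is all of `Yᶜ`, and then the complement of `Y₁` lies in `Y`.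
  obtain ⟨Y₁, hY₁, hsub⟩ : ∃ Y₁, H.Bounds Y₁ (d :: q ++ k₂) ∧ Y₁ ⊆ Y := by
    obtain ⟨Y₁, hY₁⟩ := hH.exists_bounds hcA.2.1.choose_spec hcA.2.2.2
    have hgY' : ∀ e, H.edge e ∈ (d :: q).map H.edge →
        H.face e ∈ Y ∧ H.face (H.rev e) ∈ Y := by
      intro e he
      obtain ⟨z', hz', hze⟩ := List.mem_map.1 he
      rcases H.edge_eq_edge_iff.1 hze with rfl | rfl
      · exact hgY _ hz'
      · have := hgY _ hz'
        rw [H.rev_rev] at this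
        exact this.symm
    have hZ := hH.eq_of_bounds hc' hY (Z := Y₁ \ Y) fun e he => by
      have h1 := hY e
      have h2 := hY₁ e
      have h3 := hgY' e
      rw [List.map_append, List.mem_append] at h1 h2 he
      simp only [SameSide, Set.mem_sdiff] at *
      tauto
    have hfZ : f ∉ Y₁ \ Y := fun h => h.2 hf
    rcases hZ with h | h | h | h
    · exact ⟨Y₁, hY₁, Set.sdiff_eq_empty.1 h⟩
    · exact absurd (h ▸ Set.mem_univ f) hfZ
    · exact absurd (h.symm ▸ hf) hfZ
    · exact ⟨Y₁ᶜ, hY₁.compl, fun g hg => by_contra fun hgY => hg (h.symm ▸ hgY : g ∈ Y₁ \ Y).1⟩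
  have hdY : H.face d ∈ Y ∧ H.face (H.rev d) ∈ Y := hgY d (by simp)
  -- Both faces at `d` lie in `Y`, but `Y₁` separates them; hence both `Y₁` and `Y \ Y₁` are proper
  -- in `Y`.
  have hd₁ : ¬ H.SameSide Y₁ d := (hY₁ d).1 (by simp)
  by_cases hf₁ : f ∈ Y₁
  · refine ⟨_, Y₁, hcA, hY₁, hf₁, hsub.ssubset_of_ne ?_, hlA⟩
    rintro rfl
    exact hd₁ ⟨fun _ => hdY.2, fun _ => hdY.1⟩
  · refine ⟨_, Y \ Y₁, hcB, fun e => ?_, ⟨hf, hf₁⟩, ?_, hlB⟩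
    · exact hY.diff hY₁ hsub hge hce.2.2 e
    · refine Set.sdiff_subset.ssubset_of_ne fun h => ?_
      have : ¬ (H.face d ∈ Y₁ ∨ H.face (H.rev d) ∈ Y₁) := by
        rintro (h' | h')
        · exact (h.symm ▸ hdY.1 : H.face d ∈ Y \ Y₁).2 h'
        · exact (h.symm ▸ hdY.2 : H.face (H.rev d) ∈ Y \ Y₁).2 h'
      exact hd₁ ⟨fun h => absurd (Or.inl h) this, fun h => absurd (Or.inr h) this⟩

theorem IsWalk.end_unique {u v v' : H.Vertex} {p : List D} (h : H.IsWalk u p v)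
    (h' : H.IsWalk u p v') : v = v' := by
  have := h.cons_map_head.symm.trans h'.cons_map_head
  simpa using this

theorem IsGeodesic.of_append {w : H.Edge → ℝ≥0∞} {a b : H.Vertex} {p q : List D}
    (h : H.IsGeodesic w a (p ++ q) b) : ∃ m, H.IsWalk a p m ∧ H.IsGeodesic w m q b := by
  obtain ⟨m, hp, hq⟩ := H.isWalk_append.1 h.1.1
  refine ⟨m, hp, ⟨hq, ?_⟩, fun p' q' s x y q'' hqs => h.2 (p ++ p') q' s x y q'' (by simp [hqs])⟩
  have hn := h.1.2
  rw [List.map_append, ← List.cons_append, hp.cons_map_head, List.append_assoc,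
    List.singleton_append, List.nodup_append'] at hn
  exact hn.2.1

/-- Replacing a piece of a tree path by a shorter walk would shorten the whole path from the root.
-/
theorem IsShortestPathTree.isGeodesic {w : H.Edge → ℝ≥0∞} {r : H.Vertex} {T : Set H.Edge}
    (hT : H.IsShortestPathTree w r T)
    (hw : ∀ u v : H.Vertex, ∃ p, H.IsWalk u p v ∧ H.length w p ≠ ⊤) {P : List D} {v : H.Vertex}
    (hP : H.IsPath r P v) (hPT : H.EdgesIn T P) : H.IsGeodesic w r P v := by
  refine ⟨hP, ?_⟩
  rintro p q s x y q' rfl hq hq'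
  cases q with
  | nil => simp [length]
  | cons d q =>
    obtain ⟨m, hpq, hs⟩ := H.isWalk_append.1 hP.1
    obtain ⟨x', hp, hdq⟩ := H.isWalk_append.1 hpq
    obtain rfl : x' = x := hdq.1.symm.trans hq.1
    obtain rfl := hq.end_unique hdq
    have hn := hP.2
    rw [List.map_append, ← List.cons_append] at hn
    have hn₁ := hn.of_append_left
    have hn₂ := hn₁
    rw [List.map_append, ← List.cons_append] at hn₂
    have h₁ := hT.2 y (p ++ d :: q) (p ++ q') ⟨hpq, hn₁⟩
      (fun z hz => hPT z (List.mem_append_left _ hz)) (H.isWalk_append.2 ⟨_, hp, hq'⟩)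
    -- Weights may be infinite, so cancelling the length of `p` needs it finite: it is at most that
    -- of some finite walk.
    obtain ⟨p', hp', hfin⟩ := hw r x'
    have h₂ := hT.2 x' p p' ⟨hp, hn₂.of_append_left⟩
      (fun z hz => hPT z (List.mem_append_left _ (List.mem_append_left _ hz))) hp'
    rw [length_append, length_append] at h₁
    exact (ENNReal.add_le_add_iff_left (h₂.trans_lt hfin.lt_top).ne).1 h₁

theorem FaceIncEdge.faceIncVertex_tail {f : H.Face} {d : D} (h : H.FaceIncEdge f d) :
    H.FaceIncVertex f (H.tail d) := by
  rcases h with rfl | rfl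
  · exact ⟨d, rfl, rfl⟩
  · exact ⟨H.vnext d, H.tail_vnext d, H.face_vnext d⟩

theorem FaceIncEdge.faceIncVertex_head {f : H.Face} {d : D} (h : H.FaceIncEdge f d) :
    H.FaceIncVertex f (H.head d) := by
  refine FaceIncEdge.faceIncVertex_tail (d := H.rev d) ?_
  rw [FaceIncEdge, H.rev_rev]
  exact h.symm

/-! ### Uncrossing -/

/-- Uncrossing a cycle from a family of shortest paths whose ends touch faces on one side of it. -/
theorem IsSpherical.exists_cycle_avoiding [Finite D] (hH : H.IsSpherical) {w : H.Edge → ℝ≥0∞}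
    (F : Set (List D)) {c : List D} (hc : H.IsCycle c) {Y : Set H.Face} (hY : H.Bounds Y c)
    {f : H.Face} (hf : f ∈ Y)
    (hF : ∀ P ∈ F, ∃ a b, H.IsGeodesic w a P b ∧ (∃ g, H.FaceIncVertex g a ∧ g ∉ Y) ∧
      ∃ g, H.FaceIncVertex g b ∧ g ∉ Y) :
    ∃ c' Y', H.IsCycle c' ∧ H.Bounds Y' c' ∧ f ∈ Y' ∧ Y' ⊆ Y ∧ H.length w c' ≤ H.length w c ∧
      ∀ P ∈ F, ∀ d ∈ P, ¬ (H.face d ∈ Y' ∧ H.face (H.rev d) ∈ Y') := by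
  -- Each cut lowers the number of faces in `Y`, and the faces at the path ends remain outside the
  -- smaller side.
  induction hn : Y.ncard using Nat.strong_induction_on generalizing Y c with
  | _ n ih =>
    by_cases h : ∀ P ∈ F, ∀ d ∈ P, ¬ (H.face d ∈ Y ∧ H.face (H.rev d) ∈ Y)
    · exact ⟨c, Y, hc, hY, hf, subset_rfl, le_rfl, h⟩
    · push Not at h
      obtain ⟨P, hP, d, hdP, hd⟩ := h
      obtain ⟨a, b, hgeo, ⟨_, ⟨da, hda, rfl⟩, hga⟩, _, ⟨db, hdb, rfl⟩, hgb⟩ := hF P hP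
      obtain ⟨c₁, Y₁, hc₁, hY₁, hf₁, hsub, hlen⟩ := hH.exists_smaller_side hc hY hf hgeo
        ⟨da, hda, hga⟩ ⟨db, hdb, hgb⟩ ⟨d, hdP, hd⟩
      obtain ⟨c', Y', h1, h2, h3, h4, h5, h6⟩ :=
        ih Y₁.ncard (hn ▸ Set.ncard_lt_ncard hsub) hc₁ hY₁ hf₁ (fun Q hQ => by
          obtain ⟨a, b, h, ⟨g, hg, hgY⟩, g', hg', hgY'⟩ := hF Q hQ
          exact ⟨a, b, h, ⟨g, hg, fun h => hgY (hsub.1 h)⟩, g', hg', fun h => hgY' (hsub.1 h)⟩) rfl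
      exact ⟨c', Y', h1, h2, h3, h4.trans hsub.1, h5.trans hlen, h6⟩

/-- If the cycle `c` encloses a face at `e` and faces at all ends of a family of shortest paths which
together with `e` cover `s`, then `c` can be uncrossed from `s`. -/
theorem IsSpherical.exists_not_crosses [Finite D] (hH : H.IsSpherical) {w : H.Edge → ℝ≥0∞}
    {o : H.Face} {X : Set H.Face} {c : List D} (hc : H.IsCycle c)
    (hcX : H.TerminalSeparating o X c) (F : Set (List D))
    (hF : ∀ P ∈ F, ∃ a b, H.IsGeodesic w a P b ∧
      (∃ g, H.FaceIncVertex g a ∧ H.Encloses o c g) ∧ ∃ g, H.FaceIncVertex g b ∧ H.Encloses o c g)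
    {e : D} {g : H.Face} (hg : H.FaceIncEdge g e) (hgc : H.Encloses o c g) {s : List D}
    (hs : ∀ ε ∈ s.map H.edge, ε = H.edge e ∨ ∃ P ∈ F, ε ∈ P.map H.edge) :
    ∃ c', H.IsCycle c' ∧ H.TerminalSeparating o X c' ∧ ¬ H.Crosses o c' s ∧
      H.length w c' ≤ H.length w c := by
  obtain ⟨⟨t, htX, ht⟩, f, hfX, hf⟩ := hcX
  obtain ⟨Y, hY, hYo⟩ : ∃ Y, H.Bounds Y c ∧ o ∈ Y := by
    obtain ⟨Y, hY⟩ := hH.exists_bounds hc.2.1.choose_spec hc.2.2.2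
    by_cases h : o ∈ Y
    · exact ⟨Y, hY, h⟩
    · exact ⟨Yᶜ, hY.compl, h⟩
  have henc : ∀ g, H.Encloses o c g ↔ g ∉ Y := by
    intro g
    rw [hH.encloses_iff hc hY]
    tauto
  simp only [henc, not_not] at ht hf hF hgc
  obtain ⟨c', Y', hc', hY', hfY', hsub, hlen, havoid⟩ :=
    hH.exists_cycle_avoiding F hc hY hf hF
  have htY' : t ∉ Y' := fun h => ht (hsub h)
  refine ⟨c', hc', (hH.terminalSeparating_iff hc' hY' o X).2 ⟨f, hfX, t, htX, hfY', htY'⟩, ?_, hlen⟩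
  have hint : ∀ {y d : D}, H.edge y = H.edge d → H.face y ∈ Y' → H.face (H.rev y) ∈ Y' →
      H.face d ∈ Y' ∧ H.face (H.rev d) ∈ Y' := by
    intro y d h h1 h2
    rcases H.edge_eq_edge_iff.1 h with rfl | rfl
    · exact ⟨h1, h2⟩
    · exact ⟨by rwa [H.rev_rev] at h2, h1⟩
  have hsY : ∀ d, H.edge d ∈ s.map H.edge → ¬ (H.face d ∈ Y' ∧ H.face (H.rev d) ∈ Y') := by
    rintro d hd ⟨h1, h2⟩
    rcases hs _ hd with he | ⟨P, hP, hdP⟩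
    · have := hint he h1 h2
      rcases hg with rfl | rfl
      · exact hgc (hsub this.1)
      · exact hgc (hsub this.2)
    · obtain ⟨z, hz, hzd⟩ := List.mem_map.1 hdP
      exact havoid P hP z hz (hint hzd.symm h1 h2)
  have hstep : ∀ d, H.edge d ∉ s.map H.edge → H.Encloses o s (H.face (H.rev d)) →
      H.Encloses o s (H.face d) := by
    intro d hd h h'
    exact h (.head ⟨H.rev d, by rwa [edge_rev], rfl, by rw [H.rev_rev]⟩ h')
  -- Inside `Y'` no edge of `s` is crossed, so the enclosed part of `Y'` jumps only along `c'`. It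
  -- is thus empty or `Y'`; the other two options would contain `t`.
  have hZ := hH.eq_of_bounds hc' hY' (Z := {x | x ∈ Y' ∧ H.Encloses o s x}) fun d hd => by
    have h1 := hY' d
    have h2 := hsY d
    have h3 := hstep d
    have h4 := hstep (H.rev d)
    rw [H.rev_rev, edge_rev] at h4
    simp only [SameSide, Set.mem_ofPred_eq] at *
    tauto
  have hside : ∀ d ∈ c', ∃ x, H.FaceIncEdge x d ∧ x ∈ Y' := by
    intro d hd
    by_cases h : H.face d ∈ Y'
    · exact ⟨_, Or.inl rfl, h⟩
    · refine ⟨_, Or.inr rfl, by_contra fun h' => ?_⟩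
      exact (hY' d).1 (List.mem_map_of_mem hd) ⟨fun h'' => absurd h'' h, fun h'' => absurd h'' h'⟩
  have hall : (∀ x ∈ Y', H.Encloses o s x) ∨ ∀ x ∈ Y', ¬ H.Encloses o s x := by
    rcases hZ with h | h | h | h
    · exact Or.inr fun x hx hx' => (h ▸ (⟨hx, hx'⟩ : x ∈ {x | x ∈ Y' ∧ H.Encloses o s x}) :
        x ∈ (∅ : Set H.Face))
    · exact absurd (h.symm ▸ Set.mem_univ t : t ∈ {x | x ∈ Y' ∧ H.Encloses o s x}).1 htY'
    · exact Or.inl fun x hx => (h.symm ▸ hx : x ∈ {x | x ∈ Y' ∧ H.Encloses o s x}).2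
    · exact absurd (h.symm ▸ htY' : t ∈ {x | x ∈ Y' ∧ H.Encloses o s x}).1 htY'
  rw [Crosses, not_not]
  refine hall.imp (fun h d hd => ?_) fun h d hd => ?_ <;>
  · obtain ⟨x, hx, hxY⟩ := hside d hd
    exact ⟨x, hx, h x hxY⟩

/-! ### Application to the dual graph -/

theorem IsPlane.isSpherical_dual {G : RotationSystem D} (hG : G.IsPlane)
    (hconn : ∀ u v : G.dual.Vertex, ∃ p, G.dual.IsWalk u p v) : G.dual.IsSpherical where
  connected := hconn
  dual_connected := hG.connected
  euler := (add_comm _ _).trans hG.euler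

theorem edge_mem_sepCycle {Pa Pb : List D} {e : D} {ε : H.Edge}
    (h : ε ∈ (H.sepCycle Pa e Pb).map H.edge) :
    ε = H.edge e ∨ ε ∈ Pa.map H.edge ∨ ε ∈ Pb.map H.edge := by
  rw [sepCycle, List.map_append, List.map_cons, map_edge_revWalk, List.mem_append, List.mem_cons,
    List.mem_reverse] at h
  tauto

end RotationSystem
theorem mainTheorem4 {D : Type*} [Finite D]
    -- a connected plane graph `G` with dual `G*`, and edge weights
    (G : RotationSystem D) (hG : G.IsPlane) (w : G.Edge → ℝ≥0∞)
    (hw : ∀ u v : G.dual.Vertex, ∃ p, G.dual.IsWalk u p v ∧ G.dual.length w p ≠ ⊤)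
    -- the terminals, vertices of `G`, are faces of `G*`; `o` is the infinite face of `G*`
    (X : Set G.Vertex) (o : G.dual.Face)
    -- a shortest-path tree of `G*` rooted at a vertex adjacent to a terminal face `vt`
    (r : G.dual.Vertex) (T : Set G.dual.Edge) (hT : G.dual.IsShortestPathTree w r T)
    (vt : G.dual.Face) (hvtX : vt ∈ X) (hvt : G.dual.FaceIncVertex vt r)
    -- the cycle separator `S* = Pa e Pb` and a face `ve` incident to `e`
    (Pa : List D) (e : D) (Pb : List D) (hS : G.dual.IsFundamentalCycle T r Pa e Pb)
    (ve : G.dual.Face) (hve : G.dual.FaceIncEdge ve e)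
    -- a terminal-separating cycle
    (C : List D) (hC : G.dual.IsCycle C) (hCX : G.dual.TerminalSeparating o X C) :
    ((∃ (vs : G.dual.Face) (b : D) (Pb' : List D), Pb = b :: Pb' ∧ G.dual.FaceIncEdge vs b ∧
          ¬ G.dual.Encloses o (G.dual.sepCycle Pa e Pb) vs ∧
          G.dual.Encloses o C vs ∧ G.dual.Encloses o C ve) →
        ∃ C' : List D, G.dual.IsCycle C' ∧ G.dual.TerminalSeparating o X C' ∧
          ¬ G.dual.Crosses o C' (G.dual.sepCycle Pa e Pb) ∧
          G.dual.length w C' ≤ G.dual.length w C) ∧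
      (G.dual.Encloses o C vt ∧ G.dual.Encloses o C ve →
        ∃ C' : List D, G.dual.IsCycle C' ∧ G.dual.TerminalSeparating o X C' ∧
          ¬ G.dual.Crosses o C' (G.dual.sepCycle Pa e Pb) ∧
          G.dual.length w C' ≤ G.dual.length w C) := by
  obtain ⟨-, -, Q, hPa, hPaT, hPb, hPbT⟩ := hS
  have hsph := hG.isSpherical_dual fun u v => (hw u v).imp fun _ h => h.1
  have hga := hT.isGeodesic hw hPa hPaT
  have hgb := hT.isGeodesic hw hPb hPbT
  constructor
  · rintro ⟨vs, b, Pb', rfl, hvs, -, hCvs, hCve⟩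
    -- In case (i) the common part `Q` is dropped: both paths start at the common ancestor `m`, the
    -- tail of `b`, which `vs` touches.
    obtain ⟨m, hm, hga⟩ := hga.of_append
    obtain ⟨m', hm', hgb⟩ := hgb.of_append
    obtain rfl := hm.end_unique hm'
    have hvm : G.dual.FaceIncVertex vs m := hgb.1.1.1 ▸ hvs.faceIncVertex_tail
    refine hsph.exists_not_crosses hC hCX {Pa, b :: Pb'} ?_ hve hCve fun ε hε => ?_
    · rintro P (rfl | rfl)
      · exact ⟨_, _, hga, ⟨vs, hvm, hCvs⟩, ve, hve.faceIncVertex_tail, hCve⟩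
      · exact ⟨_, _, hgb, ⟨vs, hvm, hCvs⟩, ve, hve.faceIncVertex_head, hCve⟩
    · refine (RotationSystem.edge_mem_sepCycle hε).imp_right ?_
      rintro (h | h)
      · exact ⟨_, Or.inl rfl, h⟩
      · exact ⟨_, Or.inr rfl, h⟩
  · rintro ⟨hCvt, hCve⟩
    -- In case (ii) the full root paths are used, since `vt` is known to touch only `r`; they still
    -- cover `Pa` and `Pb`.
    refine hsph.exists_not_crosses hC hCX {Q ++ Pa, Q ++ Pb} ?_ hve hCve fun ε hε => ?_
    · rintro P (rfl | rfl)
      · exact ⟨_, _, hga, ⟨vt, hvt, hCvt⟩, ve, hve.faceIncVertex_tail, hCve⟩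
      · exact ⟨_, _, hgb, ⟨vt, hvt, hCvt⟩, ve, hve.faceIncVertex_head, hCve⟩
    · refine (RotationSystem.edge_mem_sepCycle hε).imp_right ?_
      rintro (h | h)
      · exact ⟨_, Or.inl rfl, by rw [List.map_append]; exact List.mem_append_right _ h⟩
      · exact ⟨_, Or.inr rfl, by rw [List.map_append]; exact List.mem_append_right _ h⟩
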